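/- Let $k$ be a field and let $H$ be an affine algebraic group scheme over $k$, with coordinate ring $k[H]$ (a commutative Hopf algebra, finitely generated as a $k$-algebra). Let $I\subseteq k[H]$ be the vanishing ideal of the identity element, and let ${\rm Dist}(H)\subseteq k[H]^*$ be the space of all linear functionals that vanish on some power of $I$. It is a $k$-algebra under $uv=(u\otimes v)\circ\Delta_{k[H]}$, with unit the evaluation at the identity, and it has the comultiplication $\Delta$ determined by $\Delta(u)(f\otimes g)=u(fg)$ for $f,g\in k[H]$. A *${\rm Dist}(H)$-algebra* is a $k$-algebra $A$ with a structure of ${\rm Dist}(H)$-module (extending its $k$-vector space structure) such that the multiplication $A\otimes A\to A$ is a morphism of ${\rm Dist}(H)$-modules, where $u\in{\rm Dist}(H)$ acts on $A\otimes A$ through $\Delta(u)$. If $A$ is a commutative domain, then this structure extends uniquely to a structure of ${\rm Dist}(H)$-algebra on the field of fractions ${\rm Frac}(A)$. A $k$-subspace $N$ of $A$ or of ${\rm Frac}(A)$ is *${\rm Dist}(H)$-stable* if $u\cdot x\in N$ for all $u\in{\rm Dist}(H)$ and $x\in N$. Let $A$ be a ${\rm Dist}(H)$-algebra which is a commutative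 domain, let $a,b,c\in A$ and let $m\ge 0$ be an integer. (i) Assume that $A$ is a unique factorisation domain and that $b$ and $c$ are coprime (every common divisor is a unit). If $Abc$ is ${\rm Dist}(H)$-stable, then so are $Ab$ and $Ac$. (ii) Assume that $A$ is a unique factorisation domain, that $b$ and $c$ are coprime and that $c\neq 0$. If the $A$-submodule $A(b/c)$ of ${\rm Frac}(A)$ is ${\rm Dist}(H)$-stable, then so are $Ab$ and $Ac$. (iii) If $Aa^m$ is ${\rm Dist}(H)$-stable and $m\neq 0$ in $k$, then $Aa$ is ${\rm Dist}(H)$-stable. -/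

import Mathlib

/-
The affine algebraic group scheme `H` over the field `k` is given by its coordinate ring `O = k[H]`,
a commutative Hopf algebra that is finitely generated as a `k`-algebra.
-/
open scoped TensorProduct

namespace GroupSchemeDist

section Basic
variable (k : Type*) [Field k] (O : Type*) [CommRing O] [HopfAlgebra k O]

/-- The vanishing ideal `I` of the identity element of `H`: the kernel of the counit of `k[H]`. -/
noncomputable def augIdeal : Ideal O := RingHom.ker (Bialgebra.counitAlgHom k O)

/-- The space `Dist_n(H)` of linear functionals on `k[H]` that vanish on `I ^ (n + 1)`. -/
def distFiltration (n : ℕ) : Submodule k (WithConv (O →ₗ[k] k)) where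
  carrier := {u | ∀ f ∈ augIdeal k O ^ (n + 1), u f = 0}
  add_mem' {u v} hu hv f hf := by
    have h1 := hu f hf
    have h2 := hv f hf
    simp_all
  zero_mem' f _ := by simp
  smul_mem' c u hu f hf := by
    have h1 := hu f hf
    simp_all

variable {k O}

lemma distFiltration_mono {m n : ℕ} (h : m ≤ n) : distFiltration k O m ≤ distFiltration k O n :=
  fun _ hu f hf => hu f (Ideal.pow_le_pow_right (by omega) hf)

lemma comul_mem_sup {f : O} (hf : f ∈ augIdeal k O) :
    CoalgebraStruct.comul (R := k) f ∈
      (augIdeal k O).map (Algebra.TensorProduct.includeLeft : O →ₐ[k] O ⊗[k] O) ⊔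
      (augIdeal k O).map (Algebra.TensorProduct.includeRight : O →ₐ[k] O ⊗[k] O) := by
  have hs : Function.Surjective (Bialgebra.counitAlgHom k O) := Bialgebra.counit_surjective
  have := Algebra.TensorProduct.map_ker (Bialgebra.counitAlgHom k O)
    (Bialgebra.counitAlgHom k O) hs hs
  unfold augIdeal
  rw [← this, RingHom.mem_ker]
  have h1 : (Bialgebra.counitAlgHom k O) f = 0 := hf
  have h2 := Coalgebra.rTensor_counit_comul (R := k) f
  have h3 : (Algebra.TensorProduct.map (Bialgebra.counitAlgHom k O) (Bialgebra.counitAlgHom k O))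
      (CoalgebraStruct.comul (R := k) f) =
      (LinearMap.lTensor k (CoalgebraStruct.counit (R := k) (A := O)))
        (LinearMap.rTensor O CoalgebraStruct.counit (CoalgebraStruct.comul (R := k) f)) := by
    generalize (CoalgebraStruct.comul (R := k) f) = t
    induction t with
    | zero => simp
    | tmul x y => simp
    | add x y hx hy => simp [hx, hy]
  rw [h3, h2]
  simp at h1 ⊢
  simp [h1]

lemma comul_mem_pow {f : O} (n : ℕ) (hf : f ∈ augIdeal k O ^ n) :
    CoalgebraStruct.comul (R := k) f ∈
      ((augIdeal k O).map (Algebra.TensorProduct.includeLeft : O →ₐ[k] O ⊗[k] O) ⊔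
      (augIdeal k O).map (Algebra.TensorProduct.includeRight : O →ₐ[k] O ⊗[k] O)) ^ n := by
  have h : (augIdeal k O) ≤ Ideal.comap (Bialgebra.comulAlgHom k O)
     ((augIdeal k O).map (Algebra.TensorProduct.includeLeft : O →ₐ[k] O ⊗[k] O) ⊔
      (augIdeal k O).map (Algebra.TensorProduct.includeRight : O →ₐ[k] O ⊗[k] O)) :=
    fun f hf => comul_mem_sup hf
  have h2 := (Ideal.le_comap_pow (Bialgebra.comulAlgHom k O) n) (Ideal.pow_right_mono h n hf)
  exact h2

lemma distFiltration_mul {m n : ℕ} {u v : WithConv (O →ₗ[k] k)} (hu : u ∈ distFiltration k O m)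
    (hv : v ∈ distFiltration k O n) : u * v ∈ distFiltration k O (m + n + 1) := by
  intro f hf
  rw [LinearMap.convMul_apply]
  have h1 := comul_mem_pow _ hf
  rw [show m + n + 1 + 1 = (m + 1) + (n + 1) by omega] at h1
  have h2 := Ideal.sup_pow_add_le_pow_sup_pow h1
  rw [← Ideal.map_pow, ← Ideal.map_pow] at h2
  generalize CoalgebraStruct.comul (R := k) f = t at h2
  obtain ⟨x, hx, y, hy, rfl⟩ := Submodule.mem_sup.1 h2
  have hx' : LinearMap.mul' k k (TensorProduct.map u.ofConv v.ofConv x) = 0 := by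
    refine Submodule.span_induction ?_ (by simp) (fun a b _ _ ha hb s => by
      rw [mul_add, map_add, map_add, ha, hb, add_zero]) ?_ hx
      (p := fun x _ => ∀ s, LinearMap.mul' k k (TensorProduct.map u.ofConv v.ofConv (s * x)) = 0)
      |> fun h => by simpa using h 1
    · rintro _ ⟨g, hg, rfl⟩ s
      induction s with
      | zero => simp
      | add a b ha hb => rw [add_mul, map_add, map_add, ha, hb, add_zero]
      | tmul a b =>
        have := hu (a * g) (Ideal.mul_mem_left _ _ hg)
        simp [this]
    · intro r z _ hz s
      simpa [mul_assoc] using hz (s * r)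
  have hy' : LinearMap.mul' k k (TensorProduct.map u.ofConv v.ofConv y) = 0 := by
    refine Submodule.span_induction ?_ (by simp) (fun a b _ _ ha hb s => by
      rw [mul_add, map_add, map_add, ha, hb, add_zero]) ?_ hy
      (p := fun x _ => ∀ s, LinearMap.mul' k k (TensorProduct.map u.ofConv v.ofConv (s * x)) = 0)
      |> fun h => by simpa using h 1
    · rintro _ ⟨g, hg, rfl⟩ s
      induction s with
      | zero => simp
      | add a b ha hb => rw [add_mul, map_add, map_add, ha, hb, add_zero]
      | tmul a b =>
        have := hv (b * g) (Ideal.mul_mem_left _ _ hg)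
        simp [this]
    · intro r z _ hz s
      simpa [mul_assoc] using hz (s * r)
  simp [hx', hy']

variable (k O) in
/-- The distributions with support in the identity, that is, the functionals that vanish on a power
of `I`. They form a subalgebra of the full dual of `k[H]`, whose product is the convolution
`u * v = (u ⊗ v) ∘ Δ` and whose unit is the evaluation at the identity. -/
def distSubalgebra : Subalgebra k (WithConv (O →ₗ[k] k)) where
  carrier := {u | ∃ n, u ∈ distFiltration k O n}
  mul_mem' := by
    rintro u v ⟨m, hm⟩ ⟨n, hn⟩
    exact ⟨_, distFiltration_mul hm hn⟩
  add_mem' := by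
    rintro u v ⟨m, hm⟩ ⟨n, hn⟩
    exact ⟨max m n, add_mem (distFiltration_mono (le_max_left _ _) hm)
      (distFiltration_mono (le_max_right _ _) hn)⟩
  algebraMap_mem' c := ⟨0, fun f hf => by
    have : CoalgebraStruct.counit (R := k) f = 0 := by simpa [augIdeal] using hf
    simp [this]⟩

variable (k O) in
/-- The algebra `Dist(H)` of distributions of `H` with support in the identity. -/
def Dist : Type _ := distSubalgebra k O

noncomputable instance : Ring (Dist k O) := inferInstanceAs (Ring (distSubalgebra k O))

noncomputable instance : Algebra k (Dist k O) :=
  inferInstanceAs (Algebra k (distSubalgebra k O))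

/-- The underlying functional. -/
def Dist.toFunctional (u : Dist k O) : O →ₗ[k] k := u.1.ofConv

variable (k) in
/-- The evaluation `u ↦ u(f)` of distributions at a function `f`. -/
def evalAt (f : O) : Dist k O →ₗ[k] k where
  toFun u := u.toFunctional f
  map_add' _ _ := rfl
  map_smul' _ _ := rfl

@[ext] lemma dist_ext {u v : Dist k O} (h : ∀ f, evalAt k f u = evalAt k f v) : u = v := by
  apply Subtype.ext
  apply WithConv.ext
  exact LinearMap.ext h

lemma evalAt_mul (f : O) (u v : Dist k O) : evalAt k f (u * v) =
    LinearMap.mul' k k (TensorProduct.map u.toFunctional v.toFunctional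
      (CoalgebraStruct.comul (R := k) f)) := rfl

lemma evalAt_one (f : O) : evalAt k f (1 : Dist k O) = CoalgebraStruct.counit (R := k) f := rfl

lemma tensor_ext {V : Type*} [AddCommGroup V] [Module k V] {s t : V ⊗[k] Dist k O}
    (h : ∀ f, (evalAt k f).lTensor V s = (evalAt k f).lTensor V t) : s = t := by
  classical
  let b := Module.Basis.ofVectorSpace k V
  apply (TensorProduct.equivFinsuppOfBasisLeft b).injective
  ext i : 1
  rw [TensorProduct.equivFinsuppOfBasisLeft_apply, TensorProduct.equivFinsuppOfBasisLeft_apply]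
  apply dist_ext
  intro f
  have key : ∀ t : V ⊗[k] Dist k O,
      evalAt k f (TensorProduct.lid k (Dist k O) ((b.coord i).rTensor _ t)) =
      TensorProduct.lid k k ((b.coord i).rTensor _ ((evalAt k f).lTensor V t)) := by
    intro t
    induction t with
    | zero => simp
    | tmul x y => simp
    | add x y hx hy => simp only [map_add, hx, hy]
  rw [key, key, h]

lemma tensor_ext₂ {s t : Dist k O ⊗[k] Dist k O}
    (h : ∀ f g, TensorProduct.map (evalAt k f) (evalAt k g) s =
      TensorProduct.map (evalAt k f) (evalAt k g) t) : s = t := by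
  apply tensor_ext
  intro g
  apply (TensorProduct.rid k _).injective
  apply dist_ext
  intro f
  have key : ∀ t : Dist k O ⊗[k] Dist k O,
      evalAt k f (TensorProduct.rid k _ ((evalAt k g).lTensor _ t)) =
      TensorProduct.rid k k (TensorProduct.map (evalAt k f) (evalAt k g) t) := by
    intro t
    induction t with
    | zero => simp
    | tmul x y => simp
    | add x y hx hy => simp only [map_add, hx, hy]
  rw [key, key, h]


variable (k) in
/-- The linear map `u ⊗ v ↦ u(f) v(g)`. -/
noncomputable def evalAt₂ (f g : O) : Dist k O ⊗[k] Dist k O →ₗ[k] k :=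
  LinearMap.mul' k k ∘ₗ TensorProduct.map (evalAt k f) (evalAt k g)

lemma evalAt₂_tmul (f g : O) (u v : Dist k O) :
    evalAt₂ k f g (u ⊗ₜ v) = evalAt k f u * evalAt k g v := by
  simp [evalAt₂]

lemma tensor_ext₂' {s t : Dist k O ⊗[k] Dist k O}
    (h : ∀ f g, evalAt₂ k f g s = evalAt₂ k f g t) : s = t := by
  apply tensor_ext₂
  intro f g
  apply (TensorProduct.lid k k).injective
  have key : ∀ t : k ⊗[k] k, TensorProduct.lid k k t = LinearMap.mul' k k t := by
    intro t
    induction t with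
    | zero => simp
    | tmul x y => simp
    | add x y hx hy => simp only [map_add, hx, hy]
  rw [key, key]
  exact h f g

section comul
variable [Algebra.FiniteType k O]

variable (k O) in
lemma finite_quotient (n : ℕ) : Module.Finite k (O ⧸ augIdeal k O ^ (n + 1)) := by
  have hle : augIdeal k O ^ (n + 1) ≤ augIdeal k O := Ideal.pow_le_self (by omega)
  have : IsNoetherianRing O := Algebra.FiniteType.isNoetherianRing k O
  let φ : (O ⧸ augIdeal k O ^ (n + 1)) →ₐ[k] k :=
    Ideal.Quotient.liftₐ _ (Bialgebra.counitAlgHom k O) (fun a ha => hle ha)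
  have hφ : ∀ x, φ (Ideal.Quotient.mk _ x) = Bialgebra.counitAlgHom k O x := fun x => rfl
  refine Module.finite_of_surjective_of_ker_le_nilradical φ ?_ ?_ (IsNoetherian.noetherian _)
  · intro c
    obtain ⟨x, hx⟩ := Bialgebra.counit_surjective (R := k) (A := O) c
    exact ⟨Ideal.Quotient.mk _ x, hx⟩
  · intro x hx
    obtain ⟨y, rfl⟩ := Ideal.Quotient.mk_surjective x
    rw [mem_nilradical]
    refine ⟨n + 1, ?_⟩
    rw [← map_pow, Ideal.Quotient.eq_zero_iff_mem]
    have hy : y ∈ augIdeal k O := hx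
    exact Ideal.pow_mem_pow hy _

lemma exists_comul (u : Dist k O) : ∃ t : Dist k O ⊗[k] Dist k O,
    ∀ f g, evalAt₂ k f g t = evalAt k (f * g) u := by
  obtain ⟨n, hn⟩ := u.2
  have := finite_quotient k O n
  let Q := O ⧸ augIdeal k O ^ (n + 1)
  let b := Module.finBasis k Q
  have hs := Ideal.Quotient.mkₐ_surjective k (augIdeal k O ^ (n + 1))
  choose s hs using hs
  let l (i) : Dist k O := ⟨WithConv.toConv (b.coord i ∘ₗ
    (Ideal.Quotient.mkₐ k (augIdeal k O ^ (n + 1))).toLinearMap), n, fun f hf => by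
      have : Ideal.Quotient.mkₐ k (augIdeal k O ^ (n + 1)) f = 0 :=
        Ideal.Quotient.eq_zero_iff_mem.2 hf
      simp only [LinearMap.comp_apply, AlgHom.toLinearMap_apply, this, map_zero]⟩
  let r (i) : Dist k O := ⟨WithConv.toConv (u.toFunctional ∘ₗ LinearMap.mulLeft k (s (b i))),
    n, fun f hf => hn _ (Ideal.mul_mem_left _ _ hf)⟩
  refine ⟨∑ i, l i ⊗ₜ r i, fun f g => ?_⟩
  rw [map_sum]
  simp_rw [evalAt₂_tmul]
  change ∑ i, b.coord i (Ideal.Quotient.mkₐ k _ f) * u.toFunctional (s (b i) * g) =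
    u.toFunctional (f * g)
  have h1 : f - ∑ i, b.coord i (Ideal.Quotient.mkₐ k _ f) • s (b i) ∈ augIdeal k O ^ (n + 1) := by
    rw [← Ideal.Quotient.eq_zero_iff_mem]
    change Ideal.Quotient.mkₐ k _ _ = 0
    rw [map_sub, map_sum]
    simp only [map_smul, hs]
    simp [b.sum_repr]
  have h2 : u.toFunctional ((f - ∑ i, b.coord i (Ideal.Quotient.mkₐ k _ f) • s (b i)) * g) = 0 :=
    hn _ (Ideal.mul_mem_right _ _ h1)
  rw [sub_mul, map_sub, sub_eq_zero, Finset.sum_mul, map_sum] at h2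
  rw [h2]
  simp only [smul_mul_assoc, map_smul, smul_eq_mul]

/-- The comultiplication of `Dist(H)` is the differential of the diagonal embedding: `Δ u` is the
unique element of `Dist(H) ⊗ Dist(H)` with `(Δ u)(f ⊗ g) = u(f g)`. The counit is `u ↦ u(1)`. -/
noncomputable instance : CoalgebraStruct k (Dist k O) where
  comul :=
    { toFun := fun u => (exists_comul u).choose
      map_add' := fun u v => by
        apply tensor_ext₂'
        intro f g
        rw [map_add, (exists_comul u).choose_spec, (exists_comul v).choose_spec,
          (exists_comul (u + v)).choose_spec, map_add]
      map_smul' := fun c u => by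
        apply tensor_ext₂'
        intro f g
        rw [map_smul, (exists_comul u).choose_spec, (exists_comul (c • u)).choose_spec, map_smul]
        rfl }
  counit := evalAt k 1

lemma evalAt₂_comul (f g : O) (u : Dist k O) :
    evalAt₂ k f g (CoalgebraStruct.comul (R := k) u) = evalAt k (f * g) u :=
  (exists_comul u).choose_spec f g

lemma counit_eq (u : Dist k O) : CoalgebraStruct.counit (R := k) u = evalAt k 1 u := rfl

lemma lTensor_evalAt_comul (f g : O) (u : Dist k O) :
    evalAt k g (TensorProduct.rid k _ ((evalAt k f).lTensor _ (CoalgebraStruct.comul (R := k) u)))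
      = evalAt k (g * f) u := by
  rw [← evalAt₂_comul]
  generalize (CoalgebraStruct.comul (R := k) u) = t
  induction t with
  | zero => simp
  | tmul x y => simp [evalAt₂_tmul, mul_comm]
  | add x y hx hy => simp only [map_add, hx, hy]

noncomputable instance : Coalgebra k (Dist k O) where
  coassoc := by
    ext u
    apply (TensorProduct.assoc k _ _ _).symm.injective
    apply tensor_ext
    intro h
    apply (TensorProduct.rid k _).injective
    apply tensor_ext₂'
    intro f g
    -- both sides pair with `f, g, h` to `u (f * g * h)`
    have e1 : ∀ t : Dist k O ⊗[k] Dist k O,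
        evalAt₂ k f g (TensorProduct.rid k _ ((evalAt k h).lTensor _
        ((CoalgebraStruct.comul (R := k)).rTensor _ t))) = evalAt₂ k (f * g) h t := by
      intro t
      induction t with
      | zero => simp
      | tmul x y => simp [evalAt₂_tmul, evalAt₂_comul, mul_comm]
      | add x y hx hy => simp only [map_add, hx, hy]
    have e2 : ∀ (x : Dist k O) (y : Dist k O ⊗[k] Dist k O),
        evalAt₂ k f g (TensorProduct.rid k _ ((evalAt k h).lTensor _
        ((TensorProduct.assoc k _ _ _).symm (x ⊗ₜ y)))) = evalAt k f x * evalAt₂ k g h y := by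
      intro x y
      induction y with
      | zero => simp
      | tmul y z => simp [evalAt₂_tmul, mul_comm, mul_left_comm]
      | add y z hy hz => simp only [map_add, TensorProduct.tmul_add, hy, hz, mul_add]
    have e3 : ∀ t : Dist k O ⊗[k] Dist k O,
        evalAt₂ k f g (TensorProduct.rid k _ ((evalAt k h).lTensor _
        ((TensorProduct.assoc k _ _ _).symm ((CoalgebraStruct.comul (R := k)).lTensor _ t)))) =
          evalAt₂ k f (g * h) t := by
      intro t
      induction t with
      | zero => simp
      | tmul x y => rw [LinearMap.lTensor_tmul, e2, evalAt₂_comul, evalAt₂_tmul]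
      | add x y hx hy => simp only [map_add, hx, hy]
    simp only [LinearMap.comp_apply, LinearEquiv.coe_coe, LinearEquiv.symm_apply_apply]
    rw [e1, e3, evalAt₂_comul, evalAt₂_comul, mul_assoc]
  rTensor_counit_comp_comul := by
    ext u
    apply (TensorProduct.lid k _).injective
    ext f
    have e : ∀ t : Dist k O ⊗[k] Dist k O,
        evalAt k f (TensorProduct.lid k _ ((CoalgebraStruct.counit (R := k)).rTensor _ t)) =
        evalAt₂ k 1 f t := by
      intro t
      induction t with
      | zero => simp
      | tmul x y => simp [evalAt₂_tmul, counit_eq]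
      | add x y hx hy => simp only [map_add, hx, hy]
    simp only [LinearMap.comp_apply]
    rw [e, evalAt₂_comul]
    simp
  lTensor_counit_comp_comul := by
    ext u
    apply (TensorProduct.rid k _).injective
    ext f
    simp only [LinearMap.comp_apply]
    change evalAt k f (TensorProduct.rid k _ ((evalAt k 1).lTensor _ _)) = _
    rw [lTensor_evalAt_comul]
    simp

instance : Coalgebra.IsCocomm k (Dist k O) where
  comm_comp_comul := by
    ext u
    apply tensor_ext₂'
    intro f g
    have e : ∀ t : Dist k O ⊗[k] Dist k O,
        evalAt₂ k f g (TensorProduct.comm k _ _ t) = evalAt₂ k g f t := by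
      intro t
      induction t with
      | zero => simp
      | tmul x y => simp [evalAt₂_tmul, mul_comm]
      | add x y hx hy => simp only [map_add, hx, hy]
    simp only [LinearMap.comp_apply, LinearEquiv.coe_coe]
    rw [e, evalAt₂_comul, evalAt₂_comul, mul_comm]

lemma evalAt_mul_repr {ι : Type*} (f : O) (𝓡 : Coalgebra.Repr k f ι) (u v : Dist k O) :
    evalAt k f (u * v) = ∑ i ∈ 𝓡.index, evalAt k (𝓡.left i) u * evalAt k (𝓡.right i) v := by
  rw [evalAt_mul, ← 𝓡.eq]
  simp only [map_sum, TensorProduct.map_tmul, LinearMap.mul'_apply]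
  rfl

noncomputable instance : Bialgebra k (Dist k O) :=
  Bialgebra.mk' k (Dist k O)
    (by rw [counit_eq, evalAt_one]; simp)
    (by
      intro u v
      rw [counit_eq, counit_eq, counit_eq, evalAt_mul, Bialgebra.comul_one,
        Algebra.TensorProduct.one_def]
      simp; rfl)
    (by
      apply tensor_ext₂'
      intro f g
      rw [evalAt₂_comul, Algebra.TensorProduct.one_def, evalAt₂_tmul, evalAt_one, evalAt_one,
        evalAt_one, Bialgebra.counit_mul])
    (by
      intro u v
      apply tensor_ext₂'
      intro f g
      rw [evalAt₂_comul]
      let ru := Coalgebra.Repr.arbitrary k u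
      let rv := Coalgebra.Repr.arbitrary k v
      let rf := Coalgebra.Repr.arbitrary k f
      let rg := Coalgebra.Repr.arbitrary k g
      have key : ∀ s t : Dist k O ⊗[k] Dist k O, evalAt₂ k f g (s * t) =
          ∑ i ∈ rf.index, ∑ j ∈ rg.index,
            evalAt₂ k (rf.left i) (rg.left j) s * evalAt₂ k (rf.right i) (rg.right j) t := by
        intro s t
        induction s with
        | zero => simp
        | add s s' hs hs' =>
          simp only [add_mul, map_add, hs, hs', Finset.sum_add_distrib]
        | tmul x x' =>
          induction t with
          | zero => simp
          | add s s' hs hs' =>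
            simp only [mul_add, map_add, hs, hs', Finset.sum_add_distrib]
          | tmul y y' =>
            rw [Algebra.TensorProduct.tmul_mul_tmul, evalAt₂_tmul, evalAt_mul_repr f rf,
              evalAt_mul_repr g rg, Finset.sum_mul_sum]
            simp only [evalAt₂_tmul]
            refine Finset.sum_congr rfl fun i _ => Finset.sum_congr rfl fun j _ => ?_
            ring
      rw [key, evalAt_mul, Bialgebra.comul_mul, ← rf.eq, ← rg.eq, Finset.sum_mul_sum]
      simp only [evalAt₂_comul, map_sum, Algebra.TensorProduct.tmul_mul_tmul,
        TensorProduct.map_tmul, LinearMap.mul'_apply]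
      rfl)


variable {B : Type*} [CommRing B] [Algebra k B]

lemma conv_mul_tmul (g h : WithConv (Dist k O →ₗ[k] B)) (x y : Dist k O) :
    LinearMap.mul' k B (TensorProduct.map g.ofConv h.ofConv (x ⊗ₜ y)) = g x * h y := by
  simp

/-- If `u` vanishes on `I ^ (N + 1)`, then `Δ u - u ⊗ 1` lies in `D ⊗ Dist`, with `D` the
space of distributions that vanish on `I ^ N`. -/
lemma exists_comul_eq (N : ℕ) (u : Dist k O)
    (hu : ∀ f ∈ augIdeal k O ^ (N + 1), evalAt k f u = 0) :
    ∃ (s : Finset (Module.Basis.ofVectorSpaceIndex k (Dist k O)))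
      (x y : Module.Basis.ofVectorSpaceIndex k (Dist k O) → Dist k O),
      (∀ i, ∀ f ∈ augIdeal k O ^ N, evalAt k f (x i) = 0) ∧
      CoalgebraStruct.comul (R := k) u = u ⊗ₜ 1 + ∑ i ∈ s, x i ⊗ₜ y i := by
  classical
  let b := Module.Basis.ofVectorSpace k (Dist k O)
  set t := CoalgebraStruct.comul (R := k) u - u ⊗ₜ[k] 1 with ht
  have hev : ∀ f ∈ augIdeal k O ^ N, TensorProduct.lid k _ ((evalAt k f).rTensor _ t) = 0 := by
    intro f hf
    ext g
    have e : ∀ t : Dist k O ⊗[k] Dist k O,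
        evalAt k g (TensorProduct.lid k _ ((evalAt k f).rTensor _ t)) = evalAt₂ k f g t := by
      intro t
      induction t with
      | zero => simp
      | tmul x y => simp [evalAt₂_tmul]
      | add x y hx hy => simp only [map_add, hx, hy]
    rw [e, ht, map_sub, evalAt₂_comul, evalAt₂_tmul, evalAt_one, map_zero]
    have h1 : g - algebraMap k O (CoalgebraStruct.counit (R := k) g) ∈ augIdeal k O := by
      simp [augIdeal]
    have h2 := hu _ (by rw [pow_succ]; exact Ideal.mul_mem_mul hf h1)
    change u.toFunctional _ = 0 at h2
    change u.toFunctional _ - u.toFunctional _ * _ = 0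
    rw [mul_sub, map_sub, mul_comm f (algebraMap _ _ _), ← Algebra.smul_def, map_smul,
      smul_eq_mul] at h2
    rw [mul_comm (u.toFunctional f)]
    exact h2
  let c := TensorProduct.equivFinsuppOfBasisRight b t
  refine ⟨c.support, c, b, ?_, ?_⟩
  · intro i f hf
    have e : ∀ t : Dist k O ⊗[k] Dist k O,
        evalAt k f (TensorProduct.rid k _ ((b.coord i).lTensor _ t)) =
        b.coord i (TensorProduct.lid k _ ((evalAt k f).rTensor _ t)) := by
      intro t
      induction t with
      | zero => simp
      | tmul x y => simp [mul_comm]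
      | add x y hx hy => simp only [map_add, hx, hy]
    change evalAt k f (TensorProduct.equivFinsuppOfBasisRight b t i) = 0
    rw [TensorProduct.equivFinsuppOfBasisRight_apply, e, hev f hf, map_zero]
  · have h1 : c.sum (fun i m => m ⊗ₜ[k] b i) = t := by
      rw [← TensorProduct.equivFinsuppOfBasisRight_symm_apply]
      exact LinearEquiv.symm_apply_apply _ _
    change _ = _ + c.sum (fun i m => m ⊗ₜ[k] b i)
    rw [h1, ht]
    abel

lemma conv_pow_apply_eq_zero (g : WithConv (Dist k O →ₗ[k] B)) (hg : g 1 = 0) (N : ℕ) :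
    ∀ u : Dist k O, (∀ f ∈ augIdeal k O ^ N, evalAt k f u = 0) → (g ^ N) u = 0 := by
  induction N with
  | zero =>
    intro u hu
    have : u = 0 := by
      ext f
      rw [hu f (by simp), map_zero]
    rw [this]
    simp
  | succ N ih =>
    intro u hu
    obtain ⟨s, x, y, hx, h⟩ := exists_comul_eq N u hu
    rw [pow_succ, LinearMap.convMul_apply, h, map_add, map_add, conv_mul_tmul, hg, mul_zero,
      zero_add, map_sum, map_sum]
    refine Finset.sum_eq_zero fun i _ => ?_
    rw [conv_mul_tmul, ih _ (hx i), zero_mul]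

lemma exists_conv_pow_eq_zero (g : WithConv (Dist k O →ₗ[k] B)) (hg : g 1 = 0) (u : Dist k O) :
    ∃ N, ∀ m, N ≤ m → (g ^ m) u = 0 := by
  obtain ⟨n, hn⟩ := u.2
  exact ⟨n + 1, fun m hm => conv_pow_apply_eq_zero g hg m u
    fun f hf => hn f (Ideal.pow_le_pow_right hm hf)⟩

lemma conv_isUnit_one_sub (g : WithConv (Dist k O →ₗ[k] B)) (hg : g 1 = 0) :
    IsUnit (1 - g) := by
  choose N hN using exists_conv_pow_eq_zero g hg
  have hS : ∀ u M, N u ≤ M →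
      ∑ m ∈ Finset.range (N u), (g ^ m) u = ∑ m ∈ Finset.range M, (g ^ m) u := by
    intro u M hM
    refine Finset.sum_subset (Finset.range_mono hM) fun m _ hm => hN u m ?_
    simpa using hm
  let S : WithConv (Dist k O →ₗ[k] B) := WithConv.toConv
    { toFun := fun u => ∑ m ∈ Finset.range (N u), (g ^ m) u
      map_add' := fun u v => by
        let M := max (N (u + v)) (max (N u) (N v))
        rw [hS _ M (by omega), hS _ M (by omega), hS _ M (by omega), ← Finset.sum_add_distrib]
        simp
      map_smul' := fun c u => by
        let M := max (N (c • u)) (N u)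
        rw [hS _ M (by omega), hS _ M (by omega)]
        simp [Finset.smul_sum] }
  have hSM : ∀ u M, N u ≤ M → S u = (∑ m ∈ Finset.range M, g ^ m) u := by
    intro u M hM
    change ∑ m ∈ Finset.range (N u), (g ^ m) u = _
    rw [hS u M hM]
    have : ∀ s : Finset ℕ, ∑ m ∈ s, (g ^ m) u = (∑ m ∈ s, g ^ m) u := by
      classical
      intro s
      induction s using Finset.induction_on with
      | empty => simp
      | insert a s ha ih =>
        rw [Finset.sum_insert ha, Finset.sum_insert ha, ih]
        rfl
    exact this _
  refine IsUnit.of_mul_eq_one S ?_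
  ext u
  let r := Coalgebra.Repr.arbitrary k u
  let M := max (N u) (r.index.sup fun i => N (r.right i))
  have h1 : ((1 - g) * S) u = ((1 - g) * ∑ m ∈ Finset.range M, g ^ m) u := by
    rw [r.convMul_apply, r.convMul_apply]
    refine Finset.sum_congr rfl fun i hi => ?_
    rw [hSM _ M]
    exact le_max_of_le_right (Finset.le_sup (f := fun i => N (r.right i)) hi)
  change ((1 - g) * S) u = _
  rw [h1, mul_neg_geom_sum]
  change (1 : WithConv (Dist k O →ₗ[k] B)) u - (g ^ M) u = _
  rw [hN u M (le_max_left _ _), sub_zero]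

lemma conv_isUnit (f : WithConv (Dist k O →ₗ[k] B)) (hf : IsUnit (f 1)) : IsUnit f := by
  obtain ⟨c, hc⟩ := hf
  have h1 : IsUnit (1 - (1 - (↑c⁻¹ : B) • f)) := by
    apply conv_isUnit_one_sub
    change (1 : WithConv (Dist k O →ₗ[k] B)) 1 - (↑c⁻¹ : B) • f 1 = 0
    rw [← hc, LinearMap.convOne_apply]
    simp
  rw [sub_sub_cancel] at h1
  have h2 : f = algebraMap B _ (c : B) * ((↑c⁻¹ : B) • f) := by
    rw [← Algebra.smul_def, smul_smul]
    simp
  rw [h2]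
  exact (c.isUnit.map _).mul h1

end comul

end Basic

section Algebras
variable {k : Type*} [Field k] {O : Type*} [CommRing O] [HopfAlgebra k O] [Algebra.FiniteType k O]

/-- The action of `Dist(H)` on the tensor product of two `Dist(H)`-modules: `u` acts as `Δ u`,
that is, `u • (x ⊗ y) = ∑ u₁ • x ⊗ u₂ • y`. -/
noncomputable def tensorAct {M N : Type*} [AddCommGroup M] [Module k M] [AddCommGroup N]
    [Module k N] (ρ : Dist k O →ₗ[k] Module.End k M) (σ : Dist k O →ₗ[k] Module.End k N) :
    Dist k O →ₗ[k] Module.End k (M ⊗[k] N) :=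
  TensorProduct.homTensorHomMap (.id k) M N M N ∘ₗ TensorProduct.map ρ σ ∘ₗ CoalgebraStruct.comul

lemma tensorAct_apply {M N : Type*} [AddCommGroup M] [Module k M] [AddCommGroup N]
    [Module k N] (ρ : Dist k O →ₗ[k] Module.End k M) (σ : Dist k O →ₗ[k] Module.End k N)
    (u : Dist k O) (x : M) (y : N) :
    tensorAct ρ σ u (x ⊗ₜ y) =
      TensorProduct.map (ρ.flip x) (σ.flip y) (CoalgebraStruct.comul (R := k) u) := by
  rw [tensorAct]
  simp only [LinearMap.comp_apply]
  generalize CoalgebraStruct.comul (R := k) u = t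
  induction t with
  | zero => simp
  | tmul a b => simp
  | add a b ha hb => simp only [map_add, LinearMap.add_apply, ha, hb]

variable (k O) in
/-- A `Dist(H)`-algebra structure on the `k`-algebra `A`: a `Dist(H)`-module structure on the
`k`-space `A`, given by the representation `act`, such that the multiplication `A ⊗ A → A` is a
morphism of `Dist(H)`-modules. (The rule `u • 1 = u(1) 1` is a consequence.) -/
structure DistAlgebra (A : Type*) [Ring A] [Algebra k A] where
  /-- The action `act u x = u • x`. -/
  act : Dist k O →ₐ[k] Module.End k A
  /-- The multiplication `A ⊗ A → A` commutes with the action of every distribution. -/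
  act_mul' : ∀ u : Dist k O, act u ∘ₗ LinearMap.mul' k A =
    LinearMap.mul' k A ∘ₗ tensorAct act.toLinearMap act.toLinearMap u

namespace DistAlgebra

/-- The subspace `N` is `Dist(H)`-stable. -/
def IsStable {A : Type*} [Ring A] [Algebra k A] (σ : DistAlgebra k O A)
    (N : Submodule k A) : Prop :=
  ∀ u : Dist k O, ∀ x ∈ N, σ.act u x ∈ N

variable {A : Type*} [CommRing A] [Algebra k A]

/-- The function `u ↦ u • x` on `Dist(H)`. -/
noncomputable def orbit (σ : DistAlgebra k O A) (x : A) : WithConv (Dist k O →ₗ[k] A) :=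
  WithConv.toConv (σ.act.toLinearMap.flip x)

lemma orbit_apply (σ : DistAlgebra k O A) (x : A) (u : Dist k O) : σ.orbit x u = σ.act u x := rfl

lemma orbit_mul (σ : DistAlgebra k O A) (x y : A) : σ.orbit (x * y) = σ.orbit x * σ.orbit y := by
  ext u
  have h := congr($(σ.act_mul' u) (x ⊗ₜ y))
  simp only [LinearMap.comp_apply, LinearMap.mul'_apply] at h
  rw [LinearMap.convMul_apply]
  change σ.act u (x * y) = _
  rw [h, tensorAct_apply]
  rfl

lemma orbit_one (σ : DistAlgebra k O A) : σ.orbit 1 = 1 := by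
  have h : IsUnit (σ.orbit 1) := by
    apply conv_isUnit
    rw [orbit_apply, map_one σ.act]
    exact isUnit_one
  have h2 := σ.orbit_mul 1 1
  rw [mul_one] at h2
  exact (h.mul_eq_left.1 h2.symm)

variable [IsDomain A] (K : Type*) [Field K] [Algebra A K] [IsFractionRing A K] [Algebra k K]
  [IsScalarTower k A K]

/-- The ring homomorphism `x ↦ (u ↦ u • x)` with values in functions to the fraction field. -/
noncomputable def orbitHom (σ : DistAlgebra k O A) : A →+* WithConv (Dist k O →ₗ[k] K) where
  toFun x := WithConv.toConv ((IsScalarTower.toAlgHom k A K).toLinearMap ∘ₗ (σ.orbit x).ofConv)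
  map_one' := by
    rw [orbit_one]
    ext u
    simp [IsScalarTower.algebraMap_apply k A K]
  map_mul' x y := by
    rw [orbit_mul, LinearMap.algHom_comp_convMul_distrib]
  map_zero' := by
    ext u
    simp [orbit]
  map_add' x y := by
    ext u
    simp [orbit]

lemma orbitHom_apply (σ : DistAlgebra k O A) (x : A) (u : Dist k O) :
    σ.orbitHom K x u = algebraMap A K (σ.act u x) := rfl

lemma isUnit_orbitHom (σ : DistAlgebra k O A) (x : nonZeroDivisors A) :
    IsUnit (σ.orbitHom K x) := by
  apply conv_isUnit
  rw [orbitHom_apply, map_one]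
  exact IsLocalization.map_units K x

/-- The unique extension to the fraction field of the ring homomorphism `x ↦ (u ↦ u • x)`. -/
noncomputable def fracOrbit (σ : DistAlgebra k O A) : K →+* WithConv (Dist k O →ₗ[k] K) :=
  IsLocalization.lift (σ.isUnit_orbitHom K)

variable {K}

lemma fracOrbit_algebraMap (σ : DistAlgebra k O A) (x : A) :
    σ.fracOrbit K (algebraMap A K x) = σ.orbitHom K x :=
  IsLocalization.lift_eq _ _

lemma fracOrbit_algebraMap_apply (σ : DistAlgebra k O A) (x : A) (u : Dist k O) :
    σ.fracOrbit K (algebraMap A K x) u = algebraMap A K (σ.act u x) := by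
  rw [fracOrbit_algebraMap, orbitHom_apply]

lemma fracOrbit_smul (σ : DistAlgebra k O A) (c : k) (x : K) :
    σ.fracOrbit K (c • x) = c • σ.fracOrbit K x := by
  have h : σ.fracOrbit K (algebraMap k K c) = c • 1 := by
    rw [IsScalarTower.algebraMap_apply k A K, fracOrbit_algebraMap, Algebra.algebraMap_eq_smul_one]
    ext u
    rw [orbitHom_apply, map_smul]
    have := congr($(σ.orbit_one) u)
    rw [orbit_apply] at this
    rw [this]
    simp [Algebra.smul_def, IsScalarTower.algebraMap_apply k A K]
  rw [Algebra.smul_def, map_mul, h, smul_mul_assoc, one_mul]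

lemma fracOrbit_apply_one (σ : DistAlgebra k O A) (x : K) : σ.fracOrbit K x 1 = x := by
  let ev : WithConv (Dist k O →ₗ[k] K) →+* K :=
    { toFun := fun f => f 1
      map_one' := by simp
      map_mul' := fun f g => by
        rw [LinearMap.convMul_apply, Bialgebra.comul_one, Algebra.TensorProduct.one_def,
          conv_mul_tmul]
      map_zero' := rfl
      map_add' := fun f g => rfl }
  have h : ev.comp (σ.fracOrbit K) = RingHom.id K := by
    apply IsLocalization.ringHom_ext (nonZeroDivisors A)
    ext x
    change σ.fracOrbit K (algebraMap A K x) 1 = algebraMap A K x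
    rw [fracOrbit_algebraMap_apply, map_one]
    rfl
  exact congr($h x)

lemma fracOrbit_apply_mul (σ : DistAlgebra k O A) (u v : Dist k O) (x : K) :
    σ.fracOrbit K x (u * v) = σ.fracOrbit K (σ.fracOrbit K x v) u := by
  let X := σ.fracOrbit K
  let P₁ : K →+* WithConv (Dist k O →ₗ[k] WithConv (Dist k O →ₗ[k] K)) :=
    { toFun := fun x => WithConv.toConv
        { toFun := fun v => WithConv.toConv ((X x).ofConv ∘ₗ LinearMap.mulRight k v)
          map_add' := fun v w => by
            ext u
            simp [mul_add]
          map_smul' := fun c v => by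
            ext u
            simp }
      map_one' := by
        ext v u
        rw [map_one]
        change (1 : WithConv (Dist k O →ₗ[k] K)) (u * v) = 
          (algebraMap k (WithConv (Dist k O →ₗ[k] K)) (CoalgebraStruct.counit v)) u
        rw [LinearMap.convOne_apply, LinearMap.convAlgebraMap_apply, Bialgebra.counit_mul, mul_comm,
          map_mul, Algebra.smul_def]
      map_mul' := fun x y => by
        ext v u
        let ru := Coalgebra.Repr.arbitrary k u
        let rv := Coalgebra.Repr.arbitrary k v
        rw [rv.convMul_apply, map_mul]
        have hs : ∀ (s : Finset (Dist k O × Dist k O))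
            (F : (Dist k O × Dist k O) → WithConv (Dist k O →ₗ[k] K)),
            (∑ j ∈ s, F j) u = ∑ j ∈ s, F j u := by
          classical
          intro s F
          induction s using Finset.induction_on with
          | empty => simp
          | insert a s ha ih =>
            rw [Finset.sum_insert ha, Finset.sum_insert ha, ← ih]
            rfl
        rw [hs]
        simp only [ru.convMul_apply]
        change (X x * X y) (u * v) = _
        rw [LinearMap.convMul_apply, Bialgebra.comul_mul, ← ru.eq, ← rv.eq, Finset.sum_mul_sum]
        simp only [map_sum, Algebra.TensorProduct.tmul_mul_tmul, conv_mul_tmul]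
        rw [Finset.sum_comm]
        rfl
      map_zero' := by
        ext v u
        simp
      map_add' := fun x y => by
        ext v u
        simp }
  let Xₐ : K →ₐ[k] WithConv (Dist k O →ₗ[k] K) := AlgHom.ofLinearMap
    { toFun := X, map_add' := map_add X, map_smul' := σ.fracOrbit_smul } (map_one X) (map_mul X)
  let P₂ : K →+* WithConv (Dist k O →ₗ[k] WithConv (Dist k O →ₗ[k] K)) :=
    { toFun := fun x => WithConv.toConv (Xₐ.toLinearMap ∘ₗ (X x).ofConv)
      map_one' := by
        ext v u
        rw [map_one]
        change X ((1 : WithConv (Dist k O →ₗ[k] K)) v) u = 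
          (algebraMap k (WithConv (Dist k O →ₗ[k] K)) (CoalgebraStruct.counit v)) u
        rw [LinearMap.convOne_apply]
        change Xₐ _ u = _
        rw [AlgHom.commutes]
      map_mul' := fun x y => by
        rw [map_mul, LinearMap.algHom_comp_convMul_distrib]
      map_zero' := by
        ext v u
        simp
      map_add' := fun x y => by
        ext v u
        simp }
  have h : P₁ = P₂ := by
    apply IsLocalization.ringHom_ext (nonZeroDivisors A)
    ext x v u
    change σ.fracOrbit K (algebraMap A K x) (u * v) =
      σ.fracOrbit K (σ.fracOrbit K (algebraMap A K x) v) u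
    rw [fracOrbit_algebraMap_apply, fracOrbit_algebraMap_apply, fracOrbit_algebraMap_apply,
      map_mul]
    rfl
  exact congr($h x v u)

variable (K) in
/-- The action on the fraction field: `fracAct u x = u • x`. -/
noncomputable def fracAct (σ : DistAlgebra k O A) : Dist k O →ₐ[k] Module.End k K :=
  AlgHom.ofLinearMap
    { toFun := fun u =>
        { toFun := fun x => σ.fracOrbit K x u
          map_add' := fun x y => by rw [map_add]; rfl
          map_smul' := fun c x => by rw [fracOrbit_smul]; rfl }
      map_add' := fun u v => by
        ext x
        exact map_add (σ.fracOrbit K x).ofConv u v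
      map_smul' := fun c u => by
        ext x
        exact map_smul (σ.fracOrbit K x).ofConv c u }
    (LinearMap.ext fun x => σ.fracOrbit_apply_one x)
    (fun u v => LinearMap.ext fun x => σ.fracOrbit_apply_mul u v x)

lemma fracAct_apply (σ : DistAlgebra k O A) (u : Dist k O) (x : K) :
    σ.fracAct K u x = σ.fracOrbit K x u := rfl

variable (K) in
/-- The extension of a `Dist(H)`-algebra structure on a domain to its field of fractions. The next
two lemmas characterize it: it extends the given structure, and it is the only structure of
`Dist(H)`-algebra on the fraction field that does so. -/
noncomputable def fractionField (σ : DistAlgebra k O A) : DistAlgebra k O K where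
  act := σ.fracAct K
  act_mul' u := by
    apply TensorProduct.ext'
    intro x y
    rw [LinearMap.comp_apply, LinearMap.comp_apply, tensorAct_apply, LinearMap.mul'_apply,
      fracAct_apply, map_mul, LinearMap.convMul_apply]
    rfl

lemma fractionField_act_algebraMap (σ : DistAlgebra k O A) (u : Dist k O) (x : A) :
    (σ.fractionField K).act u (algebraMap A K x) = algebraMap A K (σ.act u x) :=
  σ.fracOrbit_algebraMap_apply x u

lemma eq_fractionField (σ : DistAlgebra k O A) (τ : DistAlgebra k O K)
    (h : ∀ u x, τ.act u (algebraMap A K x) = algebraMap A K (σ.act u x)) :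
    τ = σ.fractionField K := by
  have key : ∀ (τ τ' : DistAlgebra k O K), (∀ u x,
      τ.act u (algebraMap A K x) = τ'.act u (algebraMap A K x)) → τ = τ' := by
    intro τ τ' h
    have h1 : τ.orbitHom K = τ'.orbitHom K := by
      apply IsLocalization.ringHom_ext (nonZeroDivisors A)
      ext x u
      exact h u x
    cases τ
    cases τ'
    congr 1
    ext u x
    exact congr($h1 x u)
  exact key _ _ fun u x => by rw [h, fractionField_act_algebraMap]

end DistAlgebra

end Algebras

end GroupSchemeDist

/-! Everything takes place in the convolution algebras of linear maps from `Dist k O` to a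
commutative algebra `B`. They are commutative because `Dist k O` is cocommutative, and `σ.orbit : x
↦ (u ↦ u • x)` is multiplicative into the one with `B = A`. The decisive fact is `conv_isUnit`: a
function is invertible once its value at `1` is, since a function that vanishes at `1` is locally
nilpotent. The functions with all values divisible by `x` form an ideal (`dvd_conv_mul`), so `Ax` is
stable exactly when the orbit of `x` lies in that ideal.

(i) Over `A[1/c]` the orbit of `c` is invertible, so the orbit of `b` is a multiple of that of `bc`
and has values divisible by `b`. Hence `b` divides some `c ^ N * (u • b)`, and coprimality removes
the power of `c`.

(ii) The orbit of `b/c` is `(b/c) g` with `g` having values in `A` and `g 1 = 1`, so `g` is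
invertible over `A`. Now `c * (u • b) = b * (g * σ.orbit c) u`, so `b ∣ u • b` and `c` divides the
values of `g * σ.orbit c`; cancelling `g` gives the claim for `c`.

(iii) Over the fraction field let `g` be the orbit of `a` divided by `a`. Then `g 1 = 1` and `g ^ m`
has values in `A`. As `m` is invertible, approximate `m`-th roots of `g ^ m` exist over `A`
(`exists_approx_root`). They agree with `g` at any given `u` if the precision is high enough, so `g`
has values in `A` (`exists_eq_of_pow_eq`). -/

namespace GroupSchemeDist

/-! ### Quotients of linear maps, and approximate roots -/

/-- Injectivity makes the pointwise quotients unique, which forces them to depend linearly on `u`.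
This turns divisibility of all values of an orbit into a factorisation in the convolution algebra.
-/
lemma exists_linearMap_eq_mul {k V A : Type*} [CommRing k] [AddCommGroup V] [Module k V]
    [CommRing A] [Algebra k A] {K : Type*} [CommRing K] [Algebra k K] [Algebra A K]
    [IsScalarTower k A K] {x : K} (hx : Function.Injective fun r : A => x * algebraMap A K r)
    (f : V →ₗ[k] K) (hf : ∀ u, ∃ r : A, f u = x * algebraMap A K r) :
    ∃ h : V →ₗ[k] A, ∀ u, f u = x * algebraMap A K (h u) := by
  choose h hh using hf
  refine ⟨⟨⟨h, fun u v => hx ?_⟩, fun c u => hx ?_⟩, hh⟩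
  · simp only [map_add, mul_add, ← hh]
  · simp only [RingHom.id_apply, Algebra.smul_def c (h u), map_mul,
      ← IsScalarTower.algebraMap_apply k A K]
    rw [mul_left_comm, ← hh, ← hh, map_smul, Algebra.smul_def]

/-- Approximate `m`-th roots of `1 + d` in an algebra over a field in which `m ≠ 0`. -/
lemma exists_approx_root {k R : Type*} [Field k] [CommRing R] [Algebra k R] {m : ℕ}
    (hm : (m : k) ≠ 0) (d : R) (N : ℕ) : ∃ g : R, d ∣ g - 1 ∧ d ^ N ∣ g ^ m - (1 + d) := by
  -- The exponent `N + 1` lets the induction start at `g = 1`, where the error is `-d`.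
  suffices h : ∃ g : R, d ∣ g - 1 ∧ d ^ (N + 1) ∣ g ^ m - (1 + d) by
    obtain ⟨g, h1, h2⟩ := h
    exact ⟨g, h1, (pow_dvd_pow d N.le_succ).trans h2⟩
  induction N with
  | zero => exact ⟨1, by simp, by simp⟩
  | succ N ih =>
    obtain ⟨g, ⟨p, hp⟩, ⟨q, hq⟩⟩ := ih
    set i : R := algebraMap k R (m : k)⁻¹ with hi
    have him : (m : R) * i = 1 := by
      rw [hi, ← map_natCast (algebraMap k R), ← map_mul, mul_inv_cancel₀ hm, map_one]
    -- Newton step: the error `d ^ (N + 1) * q` is divided by `m` only, instead of by `m * g ^ (m -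
    -- 1)`. This suffices because `g ^ (m - 1)` is `1` modulo `d`; the quadratic term is divisible
    -- by `d ^ (2 * N + 2)`.
    obtain ⟨e, he⟩ := Polynomial.powAddExpansion g (-(i * (d ^ (N + 1) * q))) m
    obtain ⟨w, hw⟩ : d ∣ g ^ (m - 1) - 1 :=
      (Dvd.intro p hp.symm).trans (by simpa using sub_dvd_pow_sub_pow g 1 (m - 1))
    refine ⟨g + -(i * (d ^ (N + 1) * q)), ⟨p - i * d ^ N * q, ?_⟩,
      ⟨- (w * q) + e * i ^ 2 * q ^ 2 * d ^ N, ?_⟩⟩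
    · linear_combination hp
    · rw [he]
      linear_combination hq - (d ^ (N + 1) * q) * hw - g ^ (m - 1) * (d ^ (N + 1) * q) * him

/-! ### Divisibility, local nilpotence and roots in convolution algebras -/

section Convolution

variable {k : Type*} [Field k] {O : Type*} [CommRing O] [HopfAlgebra k O] [Algebra.FiniteType k O]
  {A B : Type*} [CommRing A] [Algebra k A] [CommRing B] [Algebra k B]

/-- Composition with an algebra homomorphism, as a homomorphism of convolution algebras. -/
noncomputable def convMap (φ : A →ₐ[k] B) :
    WithConv (Dist k O →ₗ[k] A) →+* WithConv (Dist k O →ₗ[k] B) where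
  toFun f := WithConv.toConv (φ.toLinearMap ∘ₗ f.ofConv)
  map_one' := by
    ext u
    simp
  map_mul' f g := by
    rw [LinearMap.algHom_comp_convMul_distrib]
  map_zero' := by
    ext u
    simp
  map_add' f g := by
    ext u
    simp

lemma convMap_apply (φ : A →ₐ[k] B) (f : WithConv (Dist k O →ₗ[k] A)) (u : Dist k O) :
    convMap φ f u = φ (f u) := rfl

lemma conv_mul_apply_one (f g : WithConv (Dist k O →ₗ[k] B)) : (f * g) 1 = f 1 * g 1 := by
  rw [LinearMap.convMul_apply, Bialgebra.comul_one, Algebra.TensorProduct.one_def, conv_mul_tmul]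

/-- The evaluation of functions on `Dist(H)` at the unit. -/
noncomputable def evalOne : WithConv (Dist k O →ₗ[k] B) →+* B where
  toFun f := f 1
  map_one' := by simp
  map_mul' := conv_mul_apply_one
  map_zero' := rfl
  map_add' _ _ := rfl

lemma evalOne_apply (f : WithConv (Dist k O →ₗ[k] B)) : evalOne f = f 1 := rfl

/-- Each term of the convolution sum contains a value of `g`. -/
lemma dvd_conv_mul {x : B} (f : WithConv (Dist k O →ₗ[k] B)) {g : WithConv (Dist k O →ₗ[k] B)}
    (hg : ∀ u, x ∣ g u) (u : Dist k O) : x ∣ (f * g) u := by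
  let r := Coalgebra.Repr.arbitrary k u
  rw [r.convMul_apply]
  exact Finset.dvd_sum fun i _ => (hg _).mul_left _

/-- The bound `N` must not depend on `w`. It can be read off from `Δ u` alone: only finitely many
left tensor factors occur, and a high power of `d` kills each of them. -/
lemma exists_conv_pow_mul_eq_zero (d : WithConv (Dist k O →ₗ[k] B)) (hd : d 1 = 0)
    (u : Dist k O) : ∃ N, ∀ w : WithConv (Dist k O →ₗ[k] B), (d ^ N * w) u = 0 := by
  let r := Coalgebra.Repr.arbitrary k u
  choose N hN using exists_conv_pow_eq_zero d hd
  refine ⟨r.index.sup fun i => N (r.left i), fun w => ?_⟩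
  rw [r.convMul_apply]
  refine Finset.sum_eq_zero fun i hi => ?_
  rw [hN _ _ (Finset.le_sup (f := fun i => N (r.left i)) hi), zero_mul]

/-- A function on `Dist(H)` with value `1` at the unit takes its values in the subring `A` if its
`m`-th power does so and `m` is invertible. -/
lemma exists_eq_of_pow_eq {m : ℕ} (hm : (m : k) ≠ 0) (φ : A →ₐ[k] B)
    {g : WithConv (Dist k O →ₗ[k] B)} (hg : g 1 = 1) {h : WithConv (Dist k O →ₗ[k] A)}
    (h1 : h 1 = 1) (hgh : g ^ m = convMap φ h) (u : Dist k O) : ∃ r, g u = φ r := by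
  have hd : (h - 1) 1 = 0 := by
    rw [← evalOne_apply, map_sub, map_one, evalOne_apply, h1, sub_self]
  have hd' : convMap φ (h - 1) 1 = 0 := by rw [convMap_apply, hd, map_zero]
  obtain ⟨N, hN⟩ := exists_conv_pow_mul_eq_zero _ hd' u
  -- The root is taken over `A`, with `d = h - 1`, to the precision at which the image of `d` over
  -- `B` becomes invisible at `u`.
  obtain ⟨s, ⟨p, hp⟩, q, hq⟩ := exists_approx_root hm (h - 1) N
  rw [add_sub_cancel] at hq
  have hs : s 1 = 1 := by
    have := congr(evalOne $hp)
    rw [map_sub, map_mul, map_one, evalOne_apply, evalOne_apply, hd, zero_mul] at this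
    exact sub_eq_zero.1 this
  -- This is the cofactor of `g - s` in `g ^ m - s ^ m`. Its value at `1` is `m`, because `g` and
  -- `s` both take the value `1` there.
  have hU : IsUnit (∑ i ∈ Finset.range m, g ^ i * convMap φ s ^ (m - 1 - i)) := by
    apply conv_isUnit
    rw [← evalOne_apply, map_sum]
    simp only [map_mul, map_pow, evalOne_apply, convMap_apply, hg, hs, map_one, one_pow, mul_one,
      Finset.sum_const, Finset.card_range, nsmul_eq_mul]
    rw [← map_natCast (algebraMap k B)]
    exact (IsUnit.mk0 _ hm).map _
  obtain ⟨U, hU⟩ := hU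
  have key : g - convMap φ s = convMap φ (h - 1) ^ N *
      (-convMap φ q * (↑U⁻¹ : WithConv (Dist k O →ₗ[k] B))) := by
    rw [← mul_assoc, Units.eq_mul_inv_iff_mul_eq, hU, mul_comm (g - _),
      Commute.geom_sum₂_mul (Commute.all _ _), hgh, ← map_pow, ← map_pow, ← map_neg,
      ← map_mul, ← map_sub, mul_neg, ← hq, neg_sub]
  refine ⟨s u, ?_⟩
  have h2 : (g - convMap φ s) u = 0 := by rw [key, hN]
  exact sub_eq_zero.1 h2

end Convolution

/-! ### Stable principal submodules -/

namespace DistAlgebra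

variable {k : Type*} [Field k] {O : Type*} [CommRing O] [HopfAlgebra k O] [Algebra.FiniteType k O]
  {A : Type*} [CommRing A] [Algebra k A] (σ : DistAlgebra k O A)

/-- Testing the generator suffices: the orbit of `r * x` is a convolution multiple of the orbit of
`x`. -/
lemma isStable_span_singleton {x : A} :
    σ.IsStable ((Ideal.span {x}).restrictScalars k) ↔ ∀ u, x ∣ σ.act u x := by
  simp only [IsStable, Submodule.restrictScalars_mem, Ideal.mem_span_singleton]
  refine ⟨fun h u => h u x dvd_rfl, ?_⟩
  rintro h u _ ⟨r, rfl⟩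
  rw [mul_comm, ← orbit_apply, orbit_mul]
  exact dvd_conv_mul _ h u

lemma orbit_apply_one (x : A) : σ.orbit x 1 = x := by
  rw [orbit_apply, map_one]
  rfl

lemma orbit_pow (x : A) (m : ℕ) : σ.orbit (x ^ m) = σ.orbit x ^ m := by
  induction m with
  | zero => rw [pow_zero, pow_zero, orbit_one]
  | succ m ih => rw [pow_succ, pow_succ, orbit_mul, ih]

/-- The orbit of `c` can be cancelled after inverting `c`, and the denominators this introduces are
prime to `b`. The localisation may be the zero ring; the argument covers `c = 0` as well. -/
lemma dvd_act_of_dvd_act_mul [DecompositionMonoid A] {b c : A} (hbc : IsRelPrime b c)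
    (h : ∀ u, b * c ∣ σ.act u (b * c)) (u : Dist k O) : b ∣ σ.act u b := by
  let L := Localization.Away c
  let φ := IsScalarTower.toAlgHom k A L
  have hU : IsUnit (convMap φ (σ.orbit c)) := by
    apply conv_isUnit
    rw [convMap_apply, orbit_apply_one]
    exact IsLocalization.Away.algebraMap_isUnit c
  obtain ⟨U, hU⟩ := hU
  have e : convMap φ (σ.orbit b) = ↑U⁻¹ * convMap φ (σ.orbit (b * c)) := by
    rw [orbit_mul, map_mul, ← hU, mul_comm, mul_assoc, Units.mul_inv, mul_one]
  have hb : algebraMap A L b ∣ algebraMap A L (σ.act u b) := by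
    change _ ∣ convMap φ (σ.orbit b) u
    rw [e]
    refine dvd_conv_mul _ (fun v => ?_) u
    exact map_dvd (algebraMap A L) ((dvd_mul_right b c).trans (h v))
  obtain ⟨z, hz⟩ := hb
  -- Descent to `A`: `c ^ n` clears the denominator of the quotient, and a further `c ^ l` turns the
  -- equality in the localisation into one in `A`.
  obtain ⟨n, y, hy⟩ := IsLocalization.Away.surj c z
  have h2 : algebraMap A L (c ^ n * σ.act u b) = algebraMap A L (b * y) := by
    rw [map_mul, map_mul, map_pow, hz, ← hy]
    ring
  obtain ⟨⟨_, l, rfl⟩, hl⟩ := (IsLocalization.eq_iff_exists (Submonoid.powers c) L).1 h2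
  refine (hbc.pow_right (n := l + n)).dvd_of_dvd_mul_left ⟨c ^ l * y, ?_⟩
  change c ^ l * _ = c ^ l * _ at hl
  linear_combination hl

variable [IsDomain A]

/-- The quotient of the orbit of `a` by `a` is an `m`-th root, normalised at `1`, of a function with
values in `A`; such a root has its values in `A` too. -/
lemma dvd_act_of_dvd_act_pow {m : ℕ} (hm : (m : k) ≠ 0) {a : A}
    (h : ∀ u, a ^ m ∣ σ.act u (a ^ m)) (u : Dist k O) : a ∣ σ.act u a := by
  rcases eq_or_ne a 0 with rfl | ha
  · simp
  let K := FractionRing A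
  let φ := IsScalarTower.toAlgHom k A K
  have hφ : Function.Injective φ := IsFractionRing.injective A K
  have haK : algebraMap A K a ≠ 0 := (map_ne_zero_iff _ hφ).2 ha
  -- Stability of `A a ^ m` provides the `m`-th power of the desired quotient as a function with
  -- values in `A`.
  obtain ⟨t, ht⟩ := exists_linearMap_eq_mul (K := A) (x := a ^ m)
    (mul_right_injective₀ (pow_ne_zero m ha)) (σ.orbit (a ^ m)).ofConv h
  let h' : WithConv (Dist k O →ₗ[k] A) := WithConv.toConv t
  have ht' : ∀ u, σ.orbit (a ^ m) u = a ^ m * h' u := ht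
  have h1 : h' 1 = 1 := by
    have := ht' 1
    rw [orbit_apply_one] at this
    exact (mul_eq_left₀ (pow_ne_zero m ha)).1 this.symm
  let g : WithConv (Dist k O →ₗ[k] K) := (algebraMap A K a)⁻¹ • convMap φ (σ.orbit a)
  have hg : ∀ u, g u = (algebraMap A K a)⁻¹ * algebraMap A K (σ.act u a) := fun _ => rfl
  have hg1 : g 1 = 1 := by
    rw [hg, ← orbit_apply, orbit_apply_one, inv_mul_cancel₀ haK]
  have hgm : g ^ m = convMap φ h' := by
    ext u
    rw [smul_pow, ← map_pow, ← orbit_pow]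
    change _ * algebraMap A K (σ.orbit (a ^ m) u) = algebraMap A K (h' u)
    rw [ht', map_mul, map_pow, inv_pow, inv_mul_cancel_left₀ (pow_ne_zero m haK)]
  obtain ⟨r, hr⟩ := exists_eq_of_pow_eq hm φ hg1 h1 hgm u
  refine ⟨r, hφ ?_⟩
  change algebraMap A K _ = algebraMap A K _
  rw [map_mul, ← mul_inv_cancel_left₀ haK (algebraMap A K (σ.act u a)), ← hg, hr]
  rfl

lemma dvd_act_of_isStable_div [DecompositionMonoid A] {b c : A} (hbc : IsRelPrime b c)
    (hc : c ≠ 0) (h : (σ.fractionField (FractionRing A)).IsStable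
      ((Submodule.span A {algebraMap A (FractionRing A) b / algebraMap A (FractionRing A) c}
        ).restrictScalars k)) :
    (∀ u, b ∣ σ.act u b) ∧ ∀ u, c ∣ σ.act u c := by
  -- If `b = 0`, coprimality makes `c` a unit; otherwise division by `b / c` is possible.
  rcases eq_or_ne b 0 with rfl | hb
  · exact ⟨by simp, fun u => (isRelPrime_zero_left.1 hbc).dvd⟩
  let K := FractionRing A
  let φ := IsScalarTower.toAlgHom k A K
  have hφ : Function.Injective (algebraMap A K) := IsFractionRing.injective A K
  have hbK : algebraMap A K b ≠ 0 := (map_ne_zero_iff _ hφ).2 hb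
  have hcK : algebraMap A K c ≠ 0 := (map_ne_zero_iff _ hφ).2 hc
  have hx : algebraMap A K b / algebraMap A K c ≠ 0 := div_ne_zero hbK hcK
  set x := algebraMap A K b / algebraMap A K c with hxdef
  obtain ⟨t, ht⟩ := exists_linearMap_eq_mul (A := A) (x := x)
    ((mul_right_injective₀ hx).comp hφ) (σ.fracOrbit K x).ofConv (fun u => by
      obtain ⟨r, hr⟩ := Submodule.mem_span_singleton.1 (h u x (Submodule.mem_span_singleton_self x))
      refine ⟨r, ?_⟩
      rw [mul_comm, ← Algebra.smul_def, hr]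
      rfl)
  let g : WithConv (Dist k O →ₗ[k] A) := WithConv.toConv t
  have hg : σ.fracOrbit K x = x • convMap φ g := WithConv.ext (LinearMap.ext ht)
  have hg1 : g 1 = 1 := by
    have h1 := ht 1
    change σ.fracOrbit K x 1 = x * algebraMap A K (g 1) at h1
    rw [fracOrbit_apply_one] at h1
    refine hφ ?_
    rw [(mul_eq_left₀ hx).1 h1.symm, map_one]
  -- Invertibility holds over `A` itself, not just over the fraction field, so multiplying by the
  -- inverse of `g` preserves divisibility in `A`.
  have hU : IsUnit g := conv_isUnit g (hg1 ▸ isUnit_one)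
  -- Multiplicativity of the orbit on `b = (b / c) * c`, with the denominator cleared.
  have key : ∀ u, c * σ.act u b = b * (g * σ.orbit c) u := by
    intro u
    have e : σ.fracOrbit K (algebraMap A K b) = x • convMap φ (g * σ.orbit c) := by
      rw [map_mul, ← smul_mul_assoc, ← hg]
      change _ = _ * σ.orbitHom K c
      rw [← fracOrbit_algebraMap, ← map_mul, hxdef, div_mul_cancel₀ _ hcK]
    have e' := congr($e u)
    rw [fracOrbit_algebraMap_apply] at e'
    change _ = x * algebraMap A K ((g * σ.orbit c) u) at e'
    refine hφ ?_
    rw [map_mul, map_mul, e', hxdef, ← mul_assoc, mul_div_cancel₀ _ hcK]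
  refine ⟨fun u => hbc.dvd_of_dvd_mul_left ⟨_, key u⟩, fun u => ?_⟩
  obtain ⟨U, hU⟩ := hU
  -- By `key`, `c` divides `b` times each value of `g * σ.orbit c`, hence the value itself;
  -- multiplying by the inverse of `g` keeps this divisibility.
  have e : σ.orbit c = ↑U⁻¹ * (g * σ.orbit c) := by rw [← hU, Units.inv_mul_cancel_left]
  rw [← orbit_apply, e]
  exact dvd_conv_mul _ (fun v => hbc.symm.dvd_of_dvd_mul_left ⟨_, (key v).symm⟩) u

end DistAlgebra

end GroupSchemeDist

open GroupSchemeDist in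
theorem mainTheorem3 {k : Type*} [Field k] {O : Type*} [CommRing O] [HopfAlgebra k O]
    [Algebra.FiniteType k O] {A : Type*} [CommRing A] [IsDomain A] [Algebra k A]
    (σ : DistAlgebra k O A) (a b c : A) (m : ℕ) :
    (UniqueFactorizationMonoid A → IsRelPrime b c →
      σ.IsStable ((Ideal.span {b * c}).restrictScalars k) →
        σ.IsStable ((Ideal.span {b}).restrictScalars k) ∧
        σ.IsStable ((Ideal.span {c}).restrictScalars k)) ∧
    (UniqueFactorizationMonoid A → IsRelPrime b c → c ≠ 0 →
      (σ.fractionField (FractionRing A)).IsStable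
        ((Submodule.span A {algebraMap A (FractionRing A) b / algebraMap A (FractionRing A) c}
          ).restrictScalars k) →
        σ.IsStable ((Ideal.span {b}).restrictScalars k) ∧
        σ.IsStable ((Ideal.span {c}).restrictScalars k)) ∧
    ((m : k) ≠ 0 →
      σ.IsStable ((Ideal.span {a ^ m}).restrictScalars k) →
        σ.IsStable ((Ideal.span {a}).restrictScalars k)) := by
  simp only [DistAlgebra.isStable_span_singleton]
  refine ⟨fun _ hbc h => ⟨σ.dvd_act_of_dvd_act_mul hbc h,
      σ.dvd_act_of_dvd_act_mul hbc.symm (by simpa only [mul_comm b c] using h)⟩,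
    fun _ hbc hc h => σ.dvd_act_of_isStable_div hbc hc h,
    fun hm h => σ.dvd_act_of_dvd_act_pow hm h⟩
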